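/- Let $d\ge 3$ and let $G\subset\mathbb{R}^d$ be open and convex. Let $R\ge\rho>0$ and let $S\subset G$ be $(R,\rho)$-relatively dense in $G$, that is, $S$ is closed in $G$ and for every $x\in G$ there is $y\in S$ with $B_\rho(y)\subset B_R(x)\cap S$, where $B_r(x)$ denotes the open ball of radius $r$ centred at $x$. Put $\Omega:=\overline G\setminus S$ and let $H^{G,S}$ be the mixed Laplacian ($-\tfrac12\Delta$ with Neumann condition on $\partial G$ and Dirichlet condition on $S$), i.e. the self-adjoint operator in $L^2(\Omega)$ associated with the closed, densely defined form $$\mathcal E^{G,S}[u,v]=\frac12\int_G \big(\nabla u(x)\,\big|\,\nabla v(x)\big)\,dx$$ whose domain is the closure of $\{u\in C^1(G)\cap C_c(\Omega): \|u\|_{1,2}<\infty\}$ in $W^{1,2}(G)$, where $\|u\|_{1,2}^2=\int_G(|\nabla u|^2+|u|^2)\,dx$ and functions on $\Omega$ are extended by $0$ to $S$. Then the bottom of the spectrum $\lambda^{G,S}:=\inf\sigma(H^{G,S})$ (with $\inf\emptyset=+\infty$) satisfies $$\lambda^{G,S}\ \ge\ \frac{d(d-2)}{3^d}\,\frac{\rho^{d-2}}{R^d}.$$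 -/

import Mathlib

open MeasureTheory Set
open scoped ContDiff ENNReal

noncomputable section

/-- `B` is `(R, δ)`-relatively dense in `G`, with covering radius `R` and thickness `δ`:
`R ≥ δ > 0`, `B` is a subset of `G` that is closed in `G`, and for every `x ∈ G` some `y ∈ B`
satisfies `B_δ(y) ⊆ B_R(x) ∩ B`. -/
def IsRelativelyDense {d : ℕ} (G B : Set (EuclideanSpace ℝ (Fin d))) (R δ : ℝ) : Prop :=
  0 < δ ∧ δ ≤ R ∧ B ⊆ G ∧ (∃ C, IsClosed C ∧ B = G ∩ C) ∧
    ∀ x ∈ G, ∃ y ∈ B, Metric.ball y δ ⊆ Metric.ball x R ∩ B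

namespace MixedLaplacian

variable {d : ℕ}

/-- The classical partial derivative `∂ᵢ φ (x)`. -/
def pderiv {F : Type*} [NormedAddCommGroup F] [NormedSpace ℝ F] (i : Fin d)
    (φ : EuclideanSpace ℝ (Fin d) → F) (x : EuclideanSpace ℝ (Fin d)) : F :=
  fderiv ℝ φ x (EuclideanSpace.single i 1)

/-- The classical gradient of a complex valued function. -/
def grad (φ : EuclideanSpace ℝ (Fin d) → ℂ) (x : EuclideanSpace ℝ (Fin d)) :
    EuclideanSpace ℂ (Fin d) :=
  WithLp.toLp 2 fun i => pderiv i φ x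

/-- `g` is the weak gradient of `u` on `G`. -/
def IsWeakGradient (G : Set (EuclideanSpace ℝ (Fin d))) (u : EuclideanSpace ℝ (Fin d) → ℂ)
    (g : EuclideanSpace ℝ (Fin d) → EuclideanSpace ℂ (Fin d)) : Prop :=
  ∀ φ : EuclideanSpace ℝ (Fin d) → ℝ, ContDiff ℝ ∞ φ → HasCompactSupport φ → tsupport φ ⊆ G →
    ∀ i : Fin d, ∫ x in G, pderiv i φ x • u x = - ∫ x in G, φ x • g x i

/-- The Hilbert space `L²(G)`. -/
abbrev L2 (G : Set (EuclideanSpace ℝ (Fin d))) : Type :=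
  Lp ℂ 2 (volume.restrict G)

/-- The Hilbert space of square integrable vector fields on `G`. -/
abbrev L2Vec (G : Set (EuclideanSpace ℝ (Fin d))) : Type :=
  Lp (EuclideanSpace ℂ (Fin d)) 2 (volume.restrict G)

/-- The Hilbert space `L²(Ω)` for `Ω = closure G \ S`, with respect to the Lebesgue measure of `G`.
(For convex `G` the boundary of `G` is a Lebesgue null set, so that this is `L²(Ω, dx)`.) -/
abbrev L2Mixed (G S : Set (EuclideanSpace ℝ (Fin d))) : Type :=
  Lp ℂ 2 ((volume.restrict G).restrict (closure G \ S))

/-- Restriction of functions `L²(G) → L²(Ω)`. -/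
def restr (G S : Set (EuclideanSpace ℝ (Fin d))) : L2 G →L[ℂ] L2Mixed G S :=
  LpToLpRestrictCLM (EuclideanSpace ℝ (Fin d)) ℂ ℂ (volume.restrict G) 2 (closure G \ S)

lemma integrable_smul_of_L2 {G : Set (EuclideanSpace ℝ (Fin d))} {F : Type*}
    [NormedAddCommGroup F] [NormedSpace ℝ F] {ψ : EuclideanSpace ℝ (Fin d) → ℝ}
    (hψ : Continuous ψ) (hc : HasCompactSupport ψ) {u : EuclideanSpace ℝ (Fin d) → F}
    (hu : MemLp u 2 (volume.restrict G)) :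
    Integrable (fun x => ψ x • u x) (volume.restrict G) :=
  memLp_one_iff_integrable.1
    (hu.smul ((hψ.memLp_of_hasCompactSupport hc : MemLp ψ 2 volume).restrict G))

lemma continuous_pderiv {φ : EuclideanSpace ℝ (Fin d) → ℝ} (hφ : ContDiff ℝ ∞ φ) (i : Fin d) :
    Continuous (pderiv i φ) :=
  (hφ.continuous_fderiv (by simp)).clm_apply continuous_const

lemma hasCompactSupport_pderiv {φ : EuclideanSpace ℝ (Fin d) → ℝ} (hc : HasCompactSupport φ)
    (i : Fin d) : HasCompactSupport (pderiv i φ) :=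
  hc.fderiv_apply (𝕜 := ℝ) _

lemma memLp_coord {G : Set (EuclideanSpace ℝ (Fin d))} (g : L2Vec G) (i : Fin d) :
    MemLp (fun x => g x i) 2 (volume.restrict G) :=
  (EuclideanSpace.proj (𝕜 := ℂ) i).comp_memLp' (Lp.memLp g)

/-- The Sobolev space `W^{1,2}(G)`, each element `u` being given together with its weak gradient, as
the pair `(u, ∇u) ∈ L²(G) × L²(G; ℂ^d)`. The topology of the product is that of the Sobolev norm. -/
def sobolev (G : Set (EuclideanSpace ℝ (Fin d))) : Submodule ℂ (L2 G × L2Vec G) where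
  carrier := {p | IsWeakGradient G p.1 p.2}
  zero_mem' := by
    intro φ hφ hc hs i
    have h1 : (fun x => pderiv i φ x • ((0 : L2 G) x)) =ᵐ[volume.restrict G] 0 := by
      filter_upwards [Lp.coeFn_zero ℂ 2 (volume.restrict G)] with x hx
      rw [hx]
      simp
    have h2 : (fun x => φ x • ((0 : L2Vec G) x i)) =ᵐ[volume.restrict G] 0 := by
      filter_upwards [Lp.coeFn_zero (EuclideanSpace ℂ (Fin d)) 2 (volume.restrict G)] with x hx
      rw [hx]
      simp
    refine (integral_congr_ae h1).trans (Eq.trans ?_ (congrArg Neg.neg (integral_congr_ae h2).symm))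
    simp
  add_mem' := by
    intro p q hp hq φ hφ hc hs i
    have h1 : (fun x => pderiv i φ x • ((p.1 + q.1 : L2 G) x)) =ᵐ[volume.restrict G]
        fun x => pderiv i φ x • p.1 x + pderiv i φ x • q.1 x := by
      filter_upwards [Lp.coeFn_add p.1 q.1] with x hx
      rw [hx]
      simp
    have h2 : (fun x => φ x • ((p.2 + q.2 : L2Vec G) x i)) =ᵐ[volume.restrict G]
        fun x => φ x • p.2 x i + φ x • q.2 x i := by
      filter_upwards [Lp.coeFn_add p.2 q.2] with x hx
      rw [hx]
      simp
    have c1 := continuous_pderiv hφ i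
    have c2 := hasCompactSupport_pderiv hc i
    refine (integral_congr_ae h1).trans (Eq.trans ?_ (congrArg Neg.neg (integral_congr_ae h2).symm))
    rw [integral_add (integrable_smul_of_L2 c1 c2 (Lp.memLp p.1))
        (integrable_smul_of_L2 c1 c2 (Lp.memLp q.1)),
      integral_add (integrable_smul_of_L2 hφ.continuous hc (memLp_coord p.2 i))
        (integrable_smul_of_L2 hφ.continuous hc (memLp_coord q.2 i)),
      hp φ hφ hc hs i, hq φ hφ hc hs i, neg_add]
  smul_mem' := by
    intro c p hp φ hφ hc hs i
    have h1 : (fun x => pderiv i φ x • ((c • p.1 : L2 G) x)) =ᵐ[volume.restrict G]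
        fun x => c • (pderiv i φ x • p.1 x) := by
      filter_upwards [Lp.coeFn_smul c p.1] with x hx
      simp [hx, mul_left_comm]
    have h2 : (fun x => φ x • ((c • p.2 : L2Vec G) x i)) =ᵐ[volume.restrict G]
        fun x => c • (φ x • p.2 x i) := by
      filter_upwards [Lp.coeFn_smul c p.2] with x hx
      simp [hx, mul_left_comm]
    refine (integral_congr_ae h1).trans (Eq.trans ?_ (congrArg Neg.neg (integral_congr_ae h2).symm))
    rw [integral_smul, integral_smul,
      hp φ hφ hc hs i, smul_neg]

/-- `φ ∈ C¹(G) ∩ C_c(Ω)` for `Ω = closure G \ S`. The function `φ` on `Ω` is continued by `0` to the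
whole space, so its support is required to be contained in a compact subset `K` of `Ω`. -/
def IsTestFunction (G S : Set (EuclideanSpace ℝ (Fin d))) (φ : EuclideanSpace ℝ (Fin d) → ℂ) :
    Prop :=
  ContDiffOn ℝ 1 φ G ∧ ContinuousOn φ (closure G \ S) ∧
    ∃ K, IsCompact K ∧ K ⊆ closure G \ S ∧ ∀ x, x ∉ K → φ x = 0

lemma IsTestFunction.differentiableAt {G S : Set (EuclideanSpace ℝ (Fin d))} (hG : IsOpen G)
    {φ : EuclideanSpace ℝ (Fin d) → ℂ} (h : IsTestFunction G S φ) {x : EuclideanSpace ℝ (Fin d)}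
    (hx : x ∈ G) : DifferentiableAt ℝ φ x :=
  (h.1.differentiableOn (by simp)).differentiableAt (hG.mem_nhds hx)

lemma IsTestFunction.add {G S : Set (EuclideanSpace ℝ (Fin d))}
    {φ ψ : EuclideanSpace ℝ (Fin d) → ℂ} (hφ : IsTestFunction G S φ) (hψ : IsTestFunction G S ψ) :
    IsTestFunction G S (φ + ψ) := by
  obtain ⟨a1, a2, K, hK, hKs, hK0⟩ := hφ
  obtain ⟨b1, b2, L, hL, hLs, hL0⟩ := hψ
  refine ⟨a1.add b1, a2.add b2, K ∪ L, hK.union hL, union_subset hKs hLs, fun x hx => ?_⟩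
  rw [mem_union, not_or] at hx
  simp [hK0 x hx.1, hL0 x hx.2]

lemma IsTestFunction.smul {G S : Set (EuclideanSpace ℝ (Fin d))}
    {φ : EuclideanSpace ℝ (Fin d) → ℂ} (c : ℂ) (hφ : IsTestFunction G S φ) :
    IsTestFunction G S (c • φ) := by
  obtain ⟨a1, a2, K, hK, hKs, hK0⟩ := hφ
  exact ⟨a1.const_smul c, a2.const_smul c, K, hK, hKs, fun x hx => by simp [hK0 x hx]⟩

/-- The space of all `u ∈ W^{1,2}(G)` (given as `(u, ∇u)`) with a representative `φ` in
`C¹(G) ∩ C_c(Ω)`. Elements of `W^{1,2}(G)` have finite Sobolev norm. -/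
def testSpace (G S : Set (EuclideanSpace ℝ (Fin d))) (hG : IsOpen G) :
    Submodule ℂ (L2 G × L2Vec G) where
  carrier := {p | p ∈ sobolev G ∧ ∃ φ, IsTestFunction G S φ ∧
    p.1 =ᵐ[volume.restrict G] φ ∧ p.2 =ᵐ[volume.restrict G] grad φ}
  zero_mem' := by
    refine ⟨(sobolev G).zero_mem, 0, ⟨contDiffOn_const, continuousOn_const, ∅, isCompact_empty,
      empty_subset _, fun x _ => rfl⟩, Lp.coeFn_zero _ _ _, ?_⟩
    filter_upwards [Lp.coeFn_zero (EuclideanSpace ℂ (Fin d)) 2 (volume.restrict G)] with x hx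
    refine hx.trans ?_
    ext i
    simp [grad, pderiv]
  add_mem' := by
    rintro p q ⟨hp, φ, hφ, p1, p2⟩ ⟨hq, ψ, hψ, q1, q2⟩
    refine ⟨(sobolev G).add_mem hp hq, φ + ψ, hφ.add hψ, (Lp.coeFn_add _ _).trans (p1.add q1), ?_⟩
    refine (Lp.coeFn_add _ _).trans ((p2.add q2).trans ?_)
    filter_upwards [ae_restrict_mem hG.measurableSet] with x hx
    ext i
    simp [grad, pderiv, fderiv_add (hφ.differentiableAt hG hx) (hψ.differentiableAt hG hx)]
  smul_mem' := by
    rintro c p ⟨hp, φ, hφ, p1, p2⟩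
    refine ⟨(sobolev G).smul_mem c hp, c • φ, hφ.smul c,
      (Lp.coeFn_smul _ _).trans (p1.const_smul c), ?_⟩
    refine (Lp.coeFn_smul _ _).trans ((p2.const_smul c).trans ?_)
    filter_upwards [ae_restrict_mem hG.measurableSet] with x hx
    ext i
    simp [grad, pderiv, fderiv_const_smul (hφ.differentiableAt hG hx)]

/-- A test function whose values and whose classical gradient are square integrable on `G` does give
an element of `W^{1,2}(G)`. -/
lemma mem_testSpace {G S : Set (EuclideanSpace ℝ (Fin d))} (hG : IsOpen G)
    {φ : EuclideanSpace ℝ (Fin d) → ℂ} (h : IsTestFunction G S φ)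
    (h1 : MemLp φ 2 (volume.restrict G)) (h2 : MemLp (grad φ) 2 (volume.restrict G)) :
    (h1.toLp φ, h2.toLp (grad φ)) ∈ testSpace G S hG := by
  refine ⟨?_, φ, h, h1.coeFn_toLp, h2.coeFn_toLp⟩
  intro ψ hψ hc hs i
  have e1 : (fun x => pderiv i ψ x • h1.toLp φ x) =ᵐ[volume.restrict G]
      fun x => pderiv i ψ x • φ x := by
    filter_upwards [h1.coeFn_toLp] with x hx
    rw [hx]
  have e2 : (fun x => ψ x • h2.toLp (grad φ) x i) =ᵐ[volume.restrict G]
      fun x => ψ x • pderiv i φ x := by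
    filter_upwards [h2.coeFn_toLp] with x hx
    rw [hx]
    rfl
  have hz : ∀ x, x ∉ G → ψ x = 0 := fun x hx => image_eq_zero_of_notMem_tsupport fun h => hx (hs h)
  have hz' : ∀ x, x ∉ G → pderiv i ψ x = 0 := fun x hx => by
    have : fderiv ℝ ψ x = 0 := by
      by_contra hne
      exact hx (hs (support_fderiv_subset ℝ hne))
    simp [pderiv, this]
  have hmem : MemLp (fun x => pderiv i φ x) 2 (volume.restrict G) :=
    (EuclideanSpace.proj (𝕜 := ℂ) i).comp_memLp' h2
  have i1 := integrable_smul_of_L2 (continuous_pderiv hψ i) (hasCompactSupport_pderiv hc i) h1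
  have i2 := integrable_smul_of_L2 hψ.continuous hc hmem
  have i3 := integrable_smul_of_L2 hψ.continuous hc h1
  rw [integral_congr_ae e1, integral_congr_ae e2,
    setIntegral_eq_integral_of_forall_compl_eq_zero (fun x hx => by simp [hz' x hx]),
    setIntegral_eq_integral_of_forall_compl_eq_zero (fun x hx => by simp [hz x hx])]
  have key : ∀ f : EuclideanSpace ℝ (Fin d) → ℂ, Integrable f (volume.restrict G) →
      (∀ x, x ∉ G → f x = 0) → Integrable f := fun f hf h0 =>
    (integrableOn_iff_integrable_of_support_subset fun x hx => by
      by_contra hxG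
      exact hx (h0 x hxG)).1 hf
  have j1 := key _ i1 fun x hx => by simp [hz' x hx]
  have j2 := key _ i2 fun x hx => by simp [hz x hx]
  have j3 := key _ i3 fun x hx => by simp [hz x hx]
  have hψd : Differentiable ℝ ψ := hψ.differentiable (by simp)
  have := integral_bilinear_fderiv_right_eq_neg_left_of_integrable (μ := volume)
    (f := φ) (g := ψ) (v := EuclideanSpace.single i 1)
    (B := (ContinuousLinearMap.lsmul ℝ ℝ : ℝ →L[ℝ] ℂ →L[ℝ] ℂ).flip) j2 j1 j3
    (fun x hx => h.differentiableAt hG (hs hx)) (fun x _ => hψd x)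
  exact this

/-- The domain of the form `𝓔^{G,S}`: the closure of `{u ∈ C¹(G) ∩ C_c(Ω) : ‖u‖_{1,2} < ∞}` in
`W^{1,2}(G)`; again, `u` is given as the pair `(u, ∇u)`. -/
def formDomain (G S : Set (EuclideanSpace ℝ (Fin d))) (hG : IsOpen G) :
    Submodule ℂ (L2 G × L2Vec G) :=
  (testSpace G S hG).topologicalClosure ⊓ sobolev G

/-- The graph of the operator associated with the form
`𝓔^{G,S}[u, v] = 1/2 ∫_G (∇u(x) | ∇v(x)) dx`: all `(u, f) ∈ L²(Ω) × L²(Ω)` such that `u` belongs to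
the form domain and `𝓔^{G,S}[u, v] = (f | v)` for every `v` in the form domain. -/
def opGraph (G S : Set (EuclideanSpace ℝ (Fin d))) (hG : IsOpen G) :
    Submodule ℂ (L2Mixed G S × L2Mixed G S) where
  carrier := {w | ∃ p ∈ formDomain G S hG, restr G S p.1 = w.1 ∧
    ∀ q ∈ formDomain G S hG, (1 / 2 : ℂ) * inner ℂ q.2 p.2 = inner ℂ (restr G S q.1) w.2}
  zero_mem' := ⟨0, Submodule.zero_mem _, by simp, fun q _ => by simp⟩
  add_mem' := by
    rintro w w' ⟨p, hp, h1, h2⟩ ⟨p', hp', h1', h2'⟩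
    refine ⟨p + p', Submodule.add_mem _ hp hp', by simp [h1, h1'], fun q hq => ?_⟩
    rw [Prod.snd_add, Prod.snd_add, inner_add_right, inner_add_right, mul_add, h2 q hq, h2' q hq]
  smul_mem' := by
    rintro c w ⟨p, hp, h1, h2⟩
    refine ⟨c • p, Submodule.smul_mem _ c hp, by simp [h1], fun q hq => ?_⟩
    rw [Prod.smul_snd, Prod.smul_snd, inner_smul_right, inner_smul_right, ← h2 q hq]
    ring

/-- The mixed Laplacian `H^{G,S}` (with the factor `1/2`), an unbounded operator in `L²(Ω)`. -/
def mixedLaplacian (G S : Set (EuclideanSpace ℝ (Fin d))) (hG : IsOpen G) :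
    L2Mixed G S →ₗ.[ℂ] L2Mixed G S :=
  (opGraph G S hG).toLinearPMap

/-- An element of the form domain vanishes on `S`. -/
lemma formDomain_ae_eq_zero {G S : Set (EuclideanSpace ℝ (Fin d))} (hG : IsOpen G)
    (hS : MeasurableSet S) {p : L2 G × L2Vec G} (hp : p ∈ formDomain G S hG) :
    p.1 =ᵐ[(volume.restrict G).restrict S] 0 := by
  let T : L2 G × L2Vec G →L[ℂ] Lp ℂ 2 ((volume.restrict G).restrict S) :=
    (LpToLpRestrictCLM (EuclideanSpace ℝ (Fin d)) ℂ ℂ (volume.restrict G) 2 S).comp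
      (ContinuousLinearMap.fst ℂ _ _)
  have hT : testSpace G S hG ≤ T.ker := by
    rintro q ⟨-, φ, ⟨-, -, K, -, hK, hK0⟩, h1, -⟩
    rw [LinearMap.mem_ker]
    apply Lp.ext
    refine (LpToLpRestrictCLM_coeFn ℂ S q.1).trans (Filter.EventuallyEq.trans ?_
      (Lp.coeFn_zero _ _ _).symm)
    filter_upwards [ae_restrict_of_ae h1, ae_restrict_mem hS] with x hx hxS
    rw [hx]
    exact hK0 x fun h => (hK h).2 hxS
  have hT' : p ∈ T.ker :=
    Submodule.topologicalClosure_minimal _ hT T.isClosed_ker hp.1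
  have h0 : T p = 0 := hT'
  refine (LpToLpRestrictCLM_coeFn ℂ S p.1).symm.trans ?_
  change (T p : EuclideanSpace ℝ (Fin d) → ℂ) =ᵐ[_] 0
  rw [h0]
  exact Lp.coeFn_zero _ _ _

lemma measurableSet_of_closedIn {G S : Set (EuclideanSpace ℝ (Fin d))} (hG : IsOpen G)
    (hS : ∃ C, IsClosed C ∧ S = G ∩ C) : MeasurableSet S := by
  obtain ⟨C, hC, rfl⟩ := hS
  exact hG.measurableSet.inter hC.measurableSet

/-- An element of the form domain is determined by its restriction to `Ω`. -/
lemma formDomain_eq_zero {G S : Set (EuclideanSpace ℝ (Fin d))} (hG : IsOpen G)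
    (hS : ∃ C, IsClosed C ∧ S = G ∩ C) {p : L2 G × L2Vec G} (hp : p ∈ formDomain G S hG)
    (h0 : restr G S p.1 = 0) : p = 0 := by
  have e1 : p.1 =ᵐ[(volume.restrict G).restrict (closure G \ S)] 0 := by
    refine (LpToLpRestrictCLM_coeFn ℂ (closure G \ S) p.1).symm.trans ?_
    change (restr G S p.1 : EuclideanSpace ℝ (Fin d) → ℂ) =ᵐ[_] 0
    rw [h0]
    exact Lp.coeFn_zero _ _ _
  have e2 := formDomain_ae_eq_zero hG (measurableSet_of_closedIn hG hS) hp
  have e3 : p.1 =ᵐ[volume.restrict G] 0 := by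
    have := (ae_restrict_union_iff _ _ _).2 ⟨e1, e2⟩
    filter_upwards [(ae_restrict_iff' ((isClosed_closure.measurableSet.diff
      (measurableSet_of_closedIn hG hS)).union (measurableSet_of_closedIn hG hS))).1 this,
      ae_restrict_mem hG.measurableSet] with x hx hxG
    refine hx ?_
    by_cases hxS : x ∈ S
    · exact Or.inr hxS
    · exact Or.inl ⟨subset_closure hxG, hxS⟩
  have f1 : p.1 = 0 := Lp.ext (e3.trans (Lp.coeFn_zero _ _ _).symm)
  have f2 : p.2 = 0 := by
    have key : ∀ i : Fin d, ∀ᵐ x ∂(volume.restrict G), x ∈ G → p.2 x i = 0 := fun i => by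
      refine hG.ae_eq_zero_of_integral_contDiff_smul_eq_zero
        (((memLp_coord p.2 i).locallyIntegrable (by norm_num)).locallyIntegrableOn G) ?_
      intro φ hφ hc hs
      have hw := hp.2 φ hφ hc hs i
      have z : (fun x => pderiv i φ x • p.1 x) =ᵐ[volume.restrict G] 0 := by
        filter_upwards [e3] with x hx
        rw [hx]
        simp
      have hz := integral_congr_ae z
      have h3 := (neg_eq_iff_eq_neg.2 (hz.symm.trans hw)).symm
      simpa using h3
    apply Lp.ext
    filter_upwards [ae_all_iff.2 key, ae_restrict_mem hG.measurableSet,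
      Lp.coeFn_zero (EuclideanSpace ℂ (Fin d)) 2 (volume.restrict G)] with x hx hxG h00
    rw [h00]
    ext i
    exact hx i hxG
  exact Prod.ext f1 f2

/-- The form is densely defined in `L²(Ω)`. -/
lemma eq_zero_of_orthogonal {G S : Set (EuclideanSpace ℝ (Fin d))} (hG : IsOpen G)
    (hS : ∃ C, IsClosed C ∧ S = G ∩ C) {f : L2Mixed G S}
    (hf : ∀ q ∈ formDomain G S hG, inner ℂ (restr G S q.1) f = 0) : f = 0 := by
  have hSm := measurableSet_of_closedIn hG hS
  have hU : IsOpen (G \ S) := by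
    obtain ⟨C, hC, rfl⟩ := hS
    rw [sdiff_self_inter]
    exact hG.sdiff hC
  have key := hU.ae_eq_zero_of_integral_contDiff_smul_eq_zero
    (μ := (volume.restrict G).restrict (closure G \ S))
    (((Lp.memLp f).locallyIntegrable (by norm_num)).locallyIntegrableOn _) (fun g hg hc hs => by
      let φ : EuclideanSpace ℝ (Fin d) → ℂ := fun x => (g x : ℂ)
      have hφ : ContDiff ℝ ∞ φ := Complex.ofRealCLM.contDiff.comp hg
      have hφc : HasCompactSupport φ := hc.comp_left (g := fun t : ℝ => (t : ℂ)) (by simp)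
      have ht : IsTestFunction G S φ := by
        refine ⟨(hφ.of_le (by simp)).contDiffOn, hφ.continuous.continuousOn, tsupport g, hc,
          hs.trans (sdiff_subset_sdiff_left subset_closure), fun x hx => ?_⟩
        simp [φ, image_eq_zero_of_notMem_tsupport hx]
      have h1 : MemLp φ 2 (volume.restrict G) :=
        (hφ.continuous.memLp_of_hasCompactSupport hφc : MemLp φ 2 volume).restrict G
      have h2 : MemLp (grad φ) 2 (volume.restrict G) := by
        have c : Continuous (grad φ) := by
          refine (PiLp.continuous_toLp 2 _).comp (continuous_pi fun i => ?_)
          exact (hφ.continuous_fderiv (by simp)).clm_apply continuous_const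
        have cc : HasCompactSupport (grad φ) := by
          refine (hφc.fderiv (𝕜 := ℝ)).mono' fun x hx => subset_tsupport _ fun h => hx ?_
          ext i
          simp [grad, pderiv, h]
        exact (c.memLp_of_hasCompactSupport cc : MemLp (grad φ) 2 volume).restrict G
      have hm := mem_testSpace hG ht h1 h2
      have h3 := hf _ ⟨Submodule.le_topologicalClosure _ hm, hm.1⟩
      rw [L2.inner_def] at h3
      rw [← h3]
      refine integral_congr_ae ?_
      filter_upwards [LpToLpRestrictCLM_coeFn ℂ (closure G \ S) (h1.toLp φ),
        ae_restrict_of_ae h1.coeFn_toLp] with x hx hx'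
      have : restr G S (h1.toLp φ) x = φ x := hx.trans hx'
      rw [this]
      simp [φ, mul_comm])
  apply Lp.ext
  filter_upwards [key, ae_restrict_of_ae (ae_restrict_mem hG.measurableSet),
    ae_restrict_mem (isClosed_closure.measurableSet.diff hSm),
    Lp.coeFn_zero ℂ 2 ((volume.restrict G).restrict (closure G \ S))] with x hx hxG hxS h00
  rw [h00]
  exact hx ⟨hxG, hxS.2⟩

/-- The set `opGraph` is the graph of the operator `mixedLaplacian`. -/
lemma mixedLaplacian_graph {G S : Set (EuclideanSpace ℝ (Fin d))} (hG : IsOpen G)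
    (hS : ∃ C, IsClosed C ∧ S = G ∩ C) : (mixedLaplacian G S hG).graph = opGraph G S hG := by
  refine Submodule.toLinearPMap_graph_eq _ ?_
  rintro ⟨u, f⟩ ⟨p, hp, h1, h2⟩ (h0 : u = 0)
  have hp0 := formDomain_eq_zero hG hS hp (h1.trans h0)
  refine eq_zero_of_orthogonal hG hS fun q hq => ?_
  rw [← h2 q hq, hp0]
  simp

end MixedLaplacian

/-- The resolvent set of an unbounded operator `T`: all `z` for which `T - z` is a bijection from the
domain of `T` onto the whole space, with bounded inverse `A`. -/
def LinearPMap.resolventSet {H : Type*} [NormedAddCommGroup H] [NormedSpace ℂ H]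
    (T : H →ₗ.[ℂ] H) : Set ℂ :=
  {z | ∃ A : H →L[ℂ] H, (∀ f : H, ∃ h : A f ∈ T.domain, T ⟨A f, h⟩ - z • A f = f) ∧
    ∀ u : T.domain, A (T u - z • (u : H)) = u}

/-- The spectrum of an unbounded operator. -/
def LinearPMap.unboundedSpectrum {H : Type*} [NormedAddCommGroup H] [NormedSpace ℂ H]
    (T : H →ₗ.[ℂ] H) : Set ℂ :=
  T.resolventSetᶜ

/-- The bottom `λ^{G,S} = inf σ(H^{G,S})` of the spectrum, with `inf ∅ = ∞`. The operator being
self-adjoint, its spectrum consists of real numbers `z = z.re`. -/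
def spectralBottom {d : ℕ} (G S : Set (EuclideanSpace ℝ (Fin d))) (hG : IsOpen G) : EReal :=
  ⨅ z ∈ (MixedLaplacian.mixedLaplacian G S hG).unboundedSpectrum, (z.re : EReal)

end

open MeasureTheory Set
open scoped ContDiff ENNReal

noncomputable section

/-! The heart is a Poincaré inequality ‖u‖² ≤ C‖∇u‖² with C = (2R)^d / (d(d-2)ρ^(d-2)). A test
function lives on a compact set K, and finitely many centres of ρ-balls inside S suffice for every
point of K ∩ G to be within 2R of one of them. Cut G into the Voronoi cells of these centres. By
convexity of G each cell is star-shaped about its centre, and in it u vanishes up to radius ρ (the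
ball lies in S) and from radius 2R on (such points are not in K). Along a ray, weighted
Cauchy–Schwarz with the Jacobian s^(d-1) gives |u(r)|² ≤ ∫_ρ^∞ s^(1-d) ds · ∫ s^(d-1)|∇u|² ds, whose
first factor is 1/((d-2)ρ^(d-2)). Integrating r^(d-1) over (0, 2R) adds the factor (2R)^d/d
(`lintegral_sq_le_of_starConvex`). Summing over cells and taking closures gives the inequality on
the form domain.

The spectral part constructs the resolvent directly and never uses self-adjointness. By Poincaré a
function u in the form domain is determined by g = ∇u, the gradients form a closed subspace W, and J
: g ↦ u is bounded with ‖J‖² ≤ C. The weak resolvent equation becomes (1/2 - z J*J) g = J* f on W.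
As J*J has spectrum in [0, C], this is solvable for Re z < 1/(2C)
(`isUnit_half_sub_smul_adjoint_mul`, `exists_resolvent_of_form`). Finally 2·2^d ≤ 3^d for d ≥ 3
turns 1/(2C) into the stated constant. -/

/-! ### Estimates along a ray, and polar coordinates -/

/-- A weighted Cauchy–Schwarz inequality. -/
lemma lintegral_sq_le_weighted {α : Type*} [MeasurableSpace α] {μ : Measure α} {h w : α → ℝ≥0∞}
    (hh : AEMeasurable h μ) (hw : AEMeasurable w μ) (h0 : ∀ᵐ x ∂μ, w x ≠ 0)
    (ht : ∀ᵐ x ∂μ, w x ≠ ⊤) :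
    (∫⁻ x, h x ∂μ) ^ 2 ≤ (∫⁻ x, h x ^ 2 * w x ∂μ) * ∫⁻ x, (w x)⁻¹ ∂μ := by
  have hpq : (2 : ℝ).HolderConjugate 2 := Real.HolderConjugate.two_two
  have key := ENNReal.lintegral_mul_le_Lp_mul_Lq μ hpq
    (f := fun x => h x * w x ^ (1 / 2 : ℝ)) (g := fun x => (w x)⁻¹ ^ (1 / 2 : ℝ))
    (hh.mul (hw.pow_const _)) (hw.inv.pow_const _)
  have e1 : ∫⁻ x, h x ∂μ
      = ∫⁻ x, ((fun x => h x * w x ^ (1 / 2 : ℝ)) * fun x => (w x)⁻¹ ^ (1 / 2 : ℝ)) x ∂μ := by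
    refine lintegral_congr_ae ?_
    filter_upwards [h0, ht] with x hx0 hxt
    rw [Pi.mul_apply, mul_assoc, ← ENNReal.mul_rpow_of_nonneg _ _ (by norm_num),
      ENNReal.mul_inv_cancel hx0 hxt, ENNReal.one_rpow, mul_one]
  have e2 : ∀ x : ℝ≥0∞, (x ^ (1 / 2 : ℝ)) ^ (2 : ℝ) = x := fun x => by
    rw [← ENNReal.rpow_mul]
    norm_num
  have e3 : ∀ x : α, (h x * w x ^ (1 / 2 : ℝ)) ^ (2 : ℝ) = h x ^ 2 * w x := fun x => by
    rw [ENNReal.mul_rpow_of_nonneg _ _ (by norm_num), e2, ENNReal.rpow_two]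
  simp only [e2, e3] at key
  rw [e1]
  refine (pow_le_pow_left' key 2).trans_eq ?_
  rw [mul_pow, ← ENNReal.rpow_two, ← ENNReal.rpow_two, e2, e2]

lemma lintegral_Icc_inv_pow_le {n : ℕ} (hn : 2 ≤ n) {a b : ℝ} (ha : 0 < a) :
    ∫⁻ s in Icc a b, (ENNReal.ofReal (s ^ n))⁻¹ ≤
      ENNReal.ofReal (1 / (((n : ℝ) - 1) * a ^ (n - 1))) := by
  have hn' : -(n : ℝ) < -1 := by
    have : (2 : ℝ) ≤ n := by exact_mod_cast hn
    linarith
  calc ∫⁻ s in Icc a b, (ENNReal.ofReal (s ^ n))⁻¹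
      ≤ ∫⁻ s in Ici a, (ENNReal.ofReal (s ^ n))⁻¹ := lintegral_mono_set Icc_subset_Ici_self
    _ = ∫⁻ s in Ioi a, (ENNReal.ofReal (s ^ n))⁻¹ := by
        rw [restrict_Ioi_eq_restrict_Ici]
    _ = ∫⁻ s in Ioi a, ENNReal.ofReal (s ^ (-(n : ℝ))) := by
        refine setLIntegral_congr_fun measurableSet_Ioi fun s hs => ?_
        have hs0 : 0 < s := ha.trans hs
        rw [Real.rpow_neg hs0.le, Real.rpow_natCast, ENNReal.ofReal_inv_of_pos (pow_pos hs0 n)]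
    _ = ENNReal.ofReal (∫ s in Ioi a, s ^ (-(n : ℝ))) := by
        rw [ofReal_integral_eq_lintegral_ofReal (integrableOn_Ioi_rpow_of_lt hn' ha)]
        filter_upwards [ae_restrict_mem measurableSet_Ioi] with s hs
        exact Real.rpow_nonneg (ha.trans hs).le _
    _ = _ := by
        rw [integral_Ioi_rpow_of_lt hn' ha]
        congr 1
        have e : -(n : ℝ) + 1 = -((n - 1 : ℕ) : ℝ) := by
          rw [Nat.cast_sub (by omega)]
          push_cast
          ring
        have hne : (n : ℝ) - 1 ≠ 0 := by linarith
        rw [e, Real.rpow_neg ha.le, Real.rpow_natCast, Nat.cast_sub (by omega)]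
        push_cast
        field_simp

/-- The one-dimensional estimate behind the Poincaré inequality on rays. -/
lemma enorm_sq_le_of_eq_zero {n : ℕ} (hn : 2 ≤ n) {a b : ℝ} (ha : 0 < a) (hab : a ≤ b)
    {f : ℝ → ℂ} (hf : ContDiffOn ℝ 1 f (Icc a b)) (h0 : f a = 0) :
    ‖f b‖ₑ ^ 2 ≤ ENNReal.ofReal (1 / (((n : ℝ) - 1) * a ^ (n - 1))) *
      ∫⁻ s in Icc a b, ENNReal.ofReal (s ^ n) * ‖deriv f s‖ₑ ^ 2 := by
  have h1 := enorm_sub_le_lintegral_deriv_of_contDiffOn_Icc hf hab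
  rw [h0, sub_zero] at h1
  have hpos : ∀ᵐ s ∂(volume.restrict (Icc a b)), 0 < s ^ n := by
    filter_upwards [ae_restrict_mem measurableSet_Icc] with s hs
    exact pow_pos (ha.trans_le hs.1) n
  have h2 := lintegral_sq_le_weighted (μ := volume.restrict (Icc a b)) (h := fun s => ‖deriv f s‖ₑ)
    (w := fun s => ENNReal.ofReal (s ^ n)) (measurable_deriv f).enorm.aemeasurable
    (by fun_prop) (by filter_upwards [hpos] with s hs using by simpa using hs)
    (by simp)
  refine (pow_le_pow_left' h1 2).trans (h2.trans ?_)
  rw [mul_comm]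
  simp_rw [mul_comm (‖deriv f _‖ₑ ^ 2)]
  gcongr
  exact lintegral_Icc_inv_pow_le hn ha

lemma lintegral_Ioo_pow (n : ℕ) {T : ℝ} (hT : 0 ≤ T) :
    ∫⁻ r in Ioo 0 T, ENNReal.ofReal (r ^ n) = ENNReal.ofReal (T ^ (n + 1) / (n + 1)) := by
  rw [Measure.restrict_congr_set Ioo_ae_eq_Ioc,
    ← ofReal_integral_eq_lintegral_ofReal (intervalIntegral.intervalIntegrable_pow _).1,
    ← intervalIntegral.integral_of_le hT]
  · simp
  · filter_upwards [ae_restrict_mem measurableSet_Ioc] with y hy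
    exact pow_nonneg hy.1.le _

/-- Integration in polar coordinates. -/
lemma lintegral_eq_lintegral_sphere {E : Type*} [NormedAddCommGroup E] [NormedSpace ℝ E]
    [MeasurableSpace E] [BorelSpace E] [FiniteDimensional ℝ E] [Nontrivial E] (μ : Measure E)
    [μ.IsAddHaarMeasure] {f : E → ℝ≥0∞} (hf : Measurable f) :
    ∫⁻ x, f x ∂μ = ∫⁻ θ, ∫⁻ r in Ioi (0 : ℝ),
      ENNReal.ofReal (r ^ (Module.finrank ℝ E - 1)) * f (r • (θ : E)) ∂volume ∂μ.toSphere := by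
  have hm : Measurable fun z : Metric.sphere (0 : E) 1 × Ioi (0 : ℝ) =>
      f ((z.2 : ℝ) • (z.1 : E)) := hf.comp (by fun_prop)
  calc ∫⁻ x, f x ∂μ = ∫⁻ x in ({0}ᶜ : Set E), f x ∂μ := by rw [restrict_compl_singleton]
    _ = ∫⁻ x : ({0}ᶜ : Set E), f x ∂(μ.comap (↑)) :=
        (lintegral_subtype_comap (measurableSet_singleton _).compl _).symm
    _ = ∫⁻ x : ({0}ᶜ : Set E), (fun z : Metric.sphere (0 : E) 1 × Ioi (0 : ℝ) =>
          f ((z.2 : ℝ) • (z.1 : E))) (homeomorphUnitSphereProd E x) ∂(μ.comap (↑)) := by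
        refine lintegral_congr fun x => ?_
        have hx : ‖(x : E)‖ ≠ 0 := norm_ne_zero_iff.2 x.2
        simp [smul_smul, hx]
    _ = ∫⁻ z, f ((z.2 : ℝ) • (z.1 : E))
          ∂(μ.toSphere.prod (Measure.volumeIoiPow (Module.finrank ℝ E - 1))) :=
        μ.measurePreserving_homeomorphUnitSphereProd.lintegral_comp hm
    _ = ∫⁻ θ, ∫⁻ r, f ((r : ℝ) • (θ : E))
          ∂(Measure.volumeIoiPow (Module.finrank ℝ E - 1)) ∂μ.toSphere :=
        lintegral_prod _ hm.aemeasurable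
    _ = _ := by
        refine lintegral_congr fun θ => ?_
        rw [Measure.volumeIoiPow, lintegral_withDensity_eq_lintegral_mul _ (by fun_prop)
          (g := fun r : Ioi (0 : ℝ) => f ((r : ℝ) • (θ : E))) (hf.comp (by fun_prop))]
        exact lintegral_subtype_comap measurableSet_Ioi
          (fun r : ℝ => ENNReal.ofReal (r ^ (Module.finrank ℝ E - 1)) * f (r • (θ : E)))

/-! ### Poincaré inequality on a star-shaped set -/

namespace MixedLaplacian
variable {d : ℕ}

/-- Cauchy–Schwarz in coordinates. For a unit vector `v` it bounds the radial derivative by the full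
gradient. -/
lemma norm_fderiv_apply_le_norm_grad {u : EuclideanSpace ℝ (Fin d) → ℂ}
    (x v : EuclideanSpace ℝ (Fin d)) : ‖fderiv ℝ u x v‖ ≤ ‖grad u x‖ * ‖v‖ := by
  have e : fderiv ℝ u x v = ∑ i, (v i : ℝ) • pderiv i u x := by
    conv_lhs => rw [← (EuclideanSpace.basisFun (Fin d) ℝ).sum_repr v]
    simp [pderiv]
  rw [e, EuclideanSpace.norm_eq, EuclideanSpace.norm_eq, mul_comm]
  calc ‖∑ i, (v i : ℝ) • pderiv i u x‖ ≤ ∑ i, ‖v i‖ * ‖pderiv i u x‖ := by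
        refine (norm_sum_le _ _).trans_eq ?_
        simp
    _ ≤ _ := Real.sum_mul_le_sqrt_mul_sqrt _ _ _

lemma continuousOn_grad {G : Set (EuclideanSpace ℝ (Fin d))} (hG : IsOpen G)
    {u : EuclideanSpace ℝ (Fin d) → ℂ} (hu : ContDiffOn ℝ 1 u G) : ContinuousOn (grad u) G := by
  refine (PiLp.continuous_toLp 2 _).comp_continuousOn (continuousOn_pi.2 fun i => ?_)
  exact (hu.continuousOn_fderiv_of_isOpen hG le_rfl).clm_apply continuousOn_const

/-- Nothing is known about `f` outside `G`, so it is cut off before the polar coordinate formula,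
which needs a measurable integrand. -/
lemma measurable_indicator_enorm_sq {F : Type*} [NormedAddCommGroup F]
    {G V : Set (EuclideanSpace ℝ (Fin d))} (hG : IsOpen G) (hVG : V ⊆ G) (hV : MeasurableSet V)
    {f : EuclideanSpace ℝ (Fin d) → F} (hf : ContinuousOn f G) :
    Measurable (V.indicator fun x => ‖f x‖ₑ ^ 2) := by
  classical
  have h : ContinuousOn (fun x => ‖f x‖ₑ ^ 2) G :=
    (ENNReal.continuous_pow 2).comp_continuousOn (continuous_enorm.comp_continuousOn hf)
  have := h.measurable_piecewise (g := fun _ => (0 : ℝ≥0∞)) continuousOn_const hG.measurableSet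
  have e : V.indicator (fun x => ‖f x‖ₑ ^ 2)
      = V.indicator (G.piecewise (fun x => ‖f x‖ₑ ^ 2) fun _ => 0) :=
    indicator_congr fun x hx => by simp [hVG hx]
  rw [e]
  exact this.indicator hV

/-- A Poincaré inequality on a set which is star-shaped with respect to the centre of a ball on which
the function vanishes. -/
lemma lintegral_sq_le_of_starConvex (hd : 3 ≤ d) {G V : Set (EuclideanSpace ℝ (Fin d))}
    (hG : IsOpen G) (hVG : V ⊆ G) (hV : MeasurableSet V) {y : EuclideanSpace ℝ (Fin d)}
    (hs : StarConvex ℝ y V) {u : EuclideanSpace ℝ (Fin d) → ℂ} (hu : ContDiffOn ℝ 1 u G)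
    {ρ T : ℝ} (hρ : 0 < ρ) (hT : 0 ≤ T) (h0 : ∀ x ∈ V, dist x y ≤ ρ → u x = 0)
    (h1 : ∀ x ∈ V, T ≤ dist x y → u x = 0) :
    ∫⁻ x in V, ‖u x‖ₑ ^ 2 ≤ ENNReal.ofReal (1 / (((d : ℝ) - 2) * ρ ^ (d - 2)) * (T ^ d / d)) *
      ∫⁻ x in V, ‖grad u x‖ₑ ^ 2 := by
  have hd0 : (3 : ℝ) ≤ d := by exact_mod_cast hd
  have : NeZero d := ⟨by omega⟩
  have : Nontrivial (EuclideanSpace ℝ (Fin d)) := inferInstance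
  have mF := measurable_indicator_enorm_sq hG hVG hV hu.continuousOn
  have mH := measurable_indicator_enorm_sq hG hVG hV (continuousOn_grad hG hu)
  set F := V.indicator fun x => ‖u x‖ₑ ^ 2 with hF
  set H := V.indicator fun x => ‖grad u x‖ₑ ^ 2 with hH
  rw [← lintegral_indicator hV, ← lintegral_indicator hV, ← hF, ← hH,
    ← lintegral_add_left_eq_self F y, ← lintegral_add_left_eq_self H y,
    lintegral_eq_lintegral_sphere volume (f := fun x => F (y + x)) (mF.comp (by fun_prop)),
    lintegral_eq_lintegral_sphere volume (f := fun x => H (y + x)) (mH.comp (by fun_prop)),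
    ← lintegral_const_mul' _ _ ENNReal.ofReal_ne_top, finrank_euclideanSpace_fin]
  refine lintegral_mono fun θ => ?_
  have hθ : ‖(θ : EuclideanSpace ℝ (Fin d))‖ = 1 := by simp
  set M := ∫⁻ r in Ioi (0 : ℝ), ENNReal.ofReal (r ^ (d - 1)) *
    H (y + r • (θ : EuclideanSpace ℝ (Fin d))) with hM
  set c := ENNReal.ofReal (1 / (((d : ℝ) - 2) * ρ ^ (d - 2))) with hc
  have hdist : ∀ r : ℝ, 0 ≤ r → dist (y + r • (θ : EuclideanSpace ℝ (Fin d))) y = r := by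
    intro r hr
    rw [dist_eq_norm, add_sub_cancel_left, norm_smul, hθ, Real.norm_of_nonneg hr, mul_one]
  have hseg : ∀ r : ℝ, 0 < r → y + r • (θ : EuclideanSpace ℝ (Fin d)) ∈ V → ∀ s, 0 ≤ s → s ≤ r →
      y + s • (θ : EuclideanSpace ℝ (Fin d)) ∈ V := by
    intro r hr hrV s hs0 hsr
    have := starConvex_iff_segment_subset.1 hs hrV
    refine this ⟨1 - s / r, s / r, by rw [sub_nonneg, div_le_one hr]; exact hsr, by positivity,
      by ring, ?_⟩
    rw [smul_add, ← add_assoc, ← add_smul, smul_smul, div_mul_cancel₀ _ hr.ne']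
    simp
  -- The bound `c * M` does not depend on `r`: `M` is the weighted gradient energy of the whole ray
  -- inside `V`.
  have point : ∀ r ∈ Ioi (0 : ℝ), F (y + r • (θ : EuclideanSpace ℝ (Fin d))) ≤
      (Ioo 0 T).indicator (fun _ => c * M) r := by
    intro r hr
    by_cases hrV : y + r • (θ : EuclideanSpace ℝ (Fin d)) ∈ V
    swap
    · simp [hF, hrV]
    rw [hF, indicator_of_mem hrV]
    rcases le_or_gt T r with hTr | hrT
    · rw [h1 _ hrV (by rwa [hdist r hr.le])]
      simp
    rw [indicator_of_mem (show r ∈ Ioo 0 T from ⟨hr, hrT⟩)]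
    rcases le_or_gt r ρ with hrρ | hρr
    · rw [h0 _ hrV (by rwa [hdist r hr.le])]
      simp
    have hmem : ∀ s ∈ Icc ρ r, y + s • (θ : EuclideanSpace ℝ (Fin d)) ∈ V := fun s hs =>
      hseg r hr hrV s (hρ.le.trans hs.1) hs.2
    have hf : ContDiffOn ℝ 1 (fun s : ℝ => u (y + s • (θ : EuclideanSpace ℝ (Fin d)))) (Icc ρ r) :=
      hu.comp (by fun_prop) fun s hs => hVG (hmem s hs)
    -- The weight exponent `d - 1` is that of the polar Jacobian; integrating its inverse from `ρ`
    -- produces the exponent `d - 2`. The estimate starts at distance exactly `ρ`, so `u` must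
    -- vanish on the closed ball.
    have key := enorm_sq_le_of_eq_zero (n := d - 1) (by omega) hρ hρr.le hf
      (h0 _ (hmem ρ ⟨le_rfl, hρr.le⟩) (by rw [hdist ρ hρ.le]))
    have e1 : ((d - 1 : ℕ) : ℝ) - 1 = (d : ℝ) - 2 := by
      rw [Nat.cast_sub (by omega)]
      push_cast
      ring
    rw [e1, show d - 1 - 1 = d - 2 by omega] at key
    refine key.trans ?_
    rw [← hc]
    gcongr
    rw [hM]
    refine le_trans ?_ (lintegral_mono_set (fun s (hs : s ∈ Icc ρ r) => hρ.trans_le hs.1))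
    refine setLIntegral_mono' measurableSet_Icc fun s hs => ?_
    rw [hH, indicator_of_mem (hmem s hs)]
    gcongr
    have hdu : HasFDerivAt u (fderiv ℝ u (y + s • (θ : EuclideanSpace ℝ (Fin d))))
        (y + s • (θ : EuclideanSpace ℝ (Fin d))) :=
      ((hu.differentiableOn (by simp)).differentiableAt
        (hG.mem_nhds (hVG (hmem s hs)))).hasFDerivAt
    have hl : HasDerivAt (fun s : ℝ => y + s • (θ : EuclideanSpace ℝ (Fin d)))
        (θ : EuclideanSpace ℝ (Fin d)) s := by
      simpa using ((hasDerivAt_id s).smul_const (θ : EuclideanSpace ℝ (Fin d))).const_add y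
    have hder := (hdu.comp_hasDerivAt s hl).deriv
    simp only [Function.comp_def] at hder
    rw [hder, enorm_le_iff_norm_le]
    simpa [hθ] using norm_fderiv_apply_le_norm_grad (u := u)
      (y + s • (θ : EuclideanSpace ℝ (Fin d))) θ
  calc ∫⁻ r in Ioi (0 : ℝ), ENNReal.ofReal (r ^ (d - 1)) *
        F (y + r • (θ : EuclideanSpace ℝ (Fin d)))
      ≤ ∫⁻ r in Ioi (0 : ℝ), ENNReal.ofReal (r ^ (d - 1)) *
          (Ioo 0 T).indicator (fun _ => c * M) r :=
        setLIntegral_mono' measurableSet_Ioi fun r hr => by gcongr; exact point r hr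
    _ ≤ ∫⁻ r, ENNReal.ofReal (r ^ (d - 1)) * (Ioo 0 T).indicator (fun _ => c * M) r :=
        setLIntegral_le_lintegral _ _
    _ = ∫⁻ r in Ioo 0 T, ENNReal.ofReal (r ^ (d - 1)) * (c * M) := by
        rw [← lintegral_indicator measurableSet_Ioo]
        refine lintegral_congr fun r => ?_
        by_cases hr : r ∈ Ioo 0 T <;> simp [hr]
    _ = ENNReal.ofReal (T ^ d / d) * (c * M) := by
        rw [lintegral_mul_const _ (by fun_prop), lintegral_Ioo_pow _ hT]
        congr 3
        · congr 1
          omega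
        · rw [Nat.cast_sub (by omega)]
          push_cast
          ring
    _ = _ := by
        rw [hc, ENNReal.ofReal_mul
          (by have : (0 : ℝ) < d - 2 := by linarith
              positivity)]
        ring

/-! ### Voronoi cells and their centres -/

/-- The part in `G` of the Voronoi cell of `p` with respect to the set `t` of centres. -/
def voronoiCell (G t : Set (EuclideanSpace ℝ (Fin d))) (p : EuclideanSpace ℝ (Fin d)) :
    Set (EuclideanSpace ℝ (Fin d)) :=
  {x ∈ G | ∀ q ∈ t, dist x p ≤ dist x q}

lemma measurableSet_voronoiCell {G : Set (EuclideanSpace ℝ (Fin d))} (hG : IsOpen G)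
    (t : Set (EuclideanSpace ℝ (Fin d))) (p : EuclideanSpace ℝ (Fin d)) :
    MeasurableSet (voronoiCell G t p) := by
  refine hG.measurableSet.inter (IsClosed.measurableSet ?_)
  have : {x | ∀ q ∈ t, dist x p ≤ dist x q} = ⋂ q ∈ t, {x | dist x p ≤ dist x q} := by
    ext x
    simp
  change IsClosed {x | ∀ q ∈ t, dist x p ≤ dist x q}
  rw [this]
  exact isClosed_biInter fun q _ => isClosed_le (by fun_prop) (by fun_prop)

/-- Moving from `x` straight towards `p` shortens the distance to `p` by the full length of the
path, and the distance to any other centre by at most that much. Convexity of `G` keeps the path in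
`G`. -/
lemma starConvex_voronoiCell {G : Set (EuclideanSpace ℝ (Fin d))} (hG : Convex ℝ G)
    (t : Set (EuclideanSpace ℝ (Fin d))) {p : EuclideanSpace ℝ (Fin d)} (hp : p ∈ G) :
    StarConvex ℝ p (voronoiCell G t p) := by
  rintro x ⟨hxG, hx⟩ a b ha hb hab
  refine ⟨hG hp hxG ha hb hab, fun q hq => ?_⟩
  obtain rfl : a = 1 - b := by linarith
  have e1 : dist ((1 - b) • p + b • x) p = b * dist x p := by
    rw [dist_eq_norm, dist_eq_norm, show (1 - b) • p + b • x - p = b • (x - p) by module,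
      norm_smul, Real.norm_of_nonneg hb]
  have e2 : dist x ((1 - b) • p + b • x) = (1 - b) * dist x p := by
    rw [dist_eq_norm, dist_eq_norm, show x - ((1 - b) • p + b • x) = (1 - b) • (x - p) by module,
      norm_smul, Real.norm_of_nonneg ha]
  have := dist_triangle x ((1 - b) • p + b • x) q
  linarith [hx q hq]

/-- Common points are equidistant from `p` and `q`, hence lie on a hyperplane. -/
lemma aedisjoint_voronoiCell (G : Set (EuclideanSpace ℝ (Fin d)))
    {t : Set (EuclideanSpace ℝ (Fin d))} {p q : EuclideanSpace ℝ (Fin d)} (hp : p ∈ t) (hq : q ∈ t)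
    (hpq : p ≠ q) : AEDisjoint volume (voronoiCell G t p) (voronoiCell G t q) := by
  refine measure_mono_null (t := (AffineSubspace.perpBisector p q : Set _)) ?_
    (Measure.addHaar_affineSubspace _ _ (by simpa using hpq))
  rintro x ⟨hxp, hxq⟩
  rw [SetLike.mem_coe, AffineSubspace.mem_perpBisector_iff_dist_eq]
  exact le_antisymm (hxp.2 q hq) (hxq.2 p hp)

/-- Cover `K ∩ G` by finitely many `R`-balls and replace each centre `x'` by a point `y` given by
relative density. This costs another `R`, hence `2 * R`. The set `K ∩ G` need not be compact, but
its closure is, and the covering centres stay in `G`, where density applies. -/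
lemma exists_finset_centres {G S : Set (EuclideanSpace ℝ (Fin d))} {R ρ : ℝ}
    (hS : IsRelativelyDense G S R ρ) {K : Set (EuclideanSpace ℝ (Fin d))} (hK : IsCompact K) :
    ∃ t : Finset (EuclideanSpace ℝ (Fin d)), (∀ y ∈ t, y ∈ G ∧ Metric.ball y ρ ⊆ S) ∧
      ∀ x ∈ K ∩ G, ∃ y ∈ t, dist x y < 2 * R := by
  classical
  obtain ⟨hρ, hρR, hSG, -, hdense⟩ := hS
  have hc : IsCompact (closure (K ∩ G)) := hK.closure_of_subset inter_subset_left
  obtain ⟨s, hs, hsf, hcov⟩ := exists_finite_cover_balls_of_isCompact_closure hc (hρ.trans_le hρR)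
  choose! y hyS hy using hdense
  refine ⟨hsf.toFinset.image y, fun z hz => ?_, fun x hx => ?_⟩
  · obtain ⟨x, hx, rfl⟩ := Finset.mem_image.1 hz
    have hxG := (hs (hsf.mem_toFinset.1 hx)).2
    exact ⟨hSG (hyS x hxG), (hy x hxG).trans inter_subset_right⟩
  · obtain ⟨x', hx', hxx'⟩ := mem_iUnion₂.1 (hcov hx)
    refine ⟨y x', Finset.mem_image_of_mem _ (hsf.mem_toFinset.2 hx'), ?_⟩
    -- The centre `y x'` belongs to its own `ρ`-ball, so it is within `R` of `x'`.
    have h1 := (hy x' (hs hx').2 (Metric.mem_ball_self hρ)).1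
    rw [Metric.mem_ball] at h1 hxx'
    rw [dist_comm] at h1
    linarith [dist_triangle x x' (y x')]

/-- Since `S` is closed in `G`, it also contains the part in `G` of the bounding sphere, where the
ray estimate begins. -/
lemma closedBall_inter_subset {G S : Set (EuclideanSpace ℝ (Fin d))} {ρ : ℝ} (hρ : 0 < ρ)
    (hS : ∃ C, IsClosed C ∧ S = G ∩ C) {y : EuclideanSpace ℝ (Fin d)}
    (hy : Metric.ball y ρ ⊆ S) : Metric.closedBall y ρ ∩ G ⊆ S := by
  obtain ⟨C, hC, rfl⟩ := hS
  rintro x ⟨hx, hxG⟩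
  rw [← closure_ball y hρ.ne'] at hx
  exact ⟨hxG, closure_minimal (hy.trans inter_subset_right) hC hx⟩

/-! ### Poincaré inequality for test functions and on the form domain -/

/-- The constant in the Poincaré inequality. -/
def poincareConst (d : ℕ) (R ρ : ℝ) : ℝ :=
  1 / (((d : ℝ) - 2) * ρ ^ (d - 2)) * ((2 * R) ^ d / d)

lemma poincareConst_pos (hd : 3 ≤ d) {R ρ : ℝ} (hρ : 0 < ρ) (hR : 0 < R) :
    0 < poincareConst d R ρ := by
  have hd0 : (3 : ℝ) ≤ d := by exact_mod_cast hd
  have : (0 : ℝ) < d - 2 := by linarith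
  have : (0 : ℝ) < d := by linarith
  rw [poincareConst]
  positivity

/-- The Poincaré inequality for test functions. -/
lemma IsTestFunction.lintegral_sq_le (hd : 3 ≤ d) {G S : Set (EuclideanSpace ℝ (Fin d))}
    (hG : IsOpen G) (hGc : Convex ℝ G) {R ρ : ℝ} (hS : IsRelativelyDense G S R ρ)
    {u : EuclideanSpace ℝ (Fin d) → ℂ} (hu : IsTestFunction G S u) :
    ∫⁻ x in G, ‖u x‖ₑ ^ 2 ≤ ENNReal.ofReal (poincareConst d R ρ) *
      ∫⁻ x in G, ‖grad u x‖ₑ ^ 2 := by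
  obtain ⟨hu1, -, K, hK, hKΩ, hK0⟩ := hu
  obtain ⟨t, ht, hcov⟩ := exists_finset_centres hS hK
  have hρ := hS.1
  have hR : 0 < R := hρ.trans_le hS.2.1
  have hcl := hS.2.2.2.1
  have hsub : ⋃ p ∈ t, voronoiCell G t p ⊆ G := iUnion₂_subset fun p _ => sep_subset _ _
  have hmeas : ∀ p, MeasurableSet (voronoiCell G (t : Set (EuclideanSpace ℝ (Fin d))) p) :=
    measurableSet_voronoiCell hG t
  have huS : ∀ x ∈ S, u x = 0 := fun x hx => hK0 x fun h => (hKΩ h).2 hx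
  have hsum : ∀ f : EuclideanSpace ℝ (Fin d) → ℝ≥0∞, ∫⁻ x in ⋃ p ∈ t, voronoiCell G t p, f x =
      ∑ p ∈ t, ∫⁻ x in voronoiCell G t p, f x := fun f =>
    lintegral_biUnion_finset₀ (fun p hp q hq hpq => aedisjoint_voronoiCell G hp hq hpq)
      (fun p _ => (hmeas p).nullMeasurableSet) f
  calc ∫⁻ x in G, ‖u x‖ₑ ^ 2 ≤ ∫⁻ x in ⋃ p ∈ t, voronoiCell G t p, ‖u x‖ₑ ^ 2 := by
        rw [← lintegral_indicator hG.measurableSet,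
          ← lintegral_indicator (Finset.measurableSet_biUnion t fun p _ => hmeas p)]
        refine lintegral_mono fun x => ?_
        by_cases hx : x ∈ ⋃ p ∈ t, voronoiCell G t p
        · rw [indicator_of_mem hx]
          exact indicator_le_self _ _ x
        by_cases hxG : x ∈ G
        -- A point of `K ∩ G` forces `t` to be nonempty and then lies in the cell of a nearest
        -- centre. So the part of `G` left uncovered, which is everything if `t` is empty, carries
        -- none of `u`.
        · have hxK : x ∉ K := fun hxK => by
            obtain ⟨y, hy, -⟩ := hcov x ⟨hxK, hxG⟩
            obtain ⟨p, hp, hmin⟩ := t.exists_min_image (fun q => dist x q) ⟨y, hy⟩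
            exact hx (mem_iUnion₂.2 ⟨p, hp, hxG, hmin⟩)
          simp [hxG, hK0 x hxK]
        · simp [hxG]
    _ = ∑ p ∈ t, ∫⁻ x in voronoiCell G t p, ‖u x‖ₑ ^ 2 := hsum _
    _ ≤ ∑ p ∈ t, ENNReal.ofReal (poincareConst d R ρ) *
          ∫⁻ x in voronoiCell G t p, ‖grad u x‖ₑ ^ 2 := by
        refine Finset.sum_le_sum fun p hp => ?_
        refine lintegral_sq_le_of_starConvex hd hG (sep_subset _ _) (hmeas p)
          (starConvex_voronoiCell hGc t (ht p hp).1) hu1 hρ (by linarith) ?_ ?_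
        · intro x hx hxp
          exact huS x (closedBall_inter_subset hρ hcl (ht p hp).2 ⟨hxp, hx.1⟩)
        -- Here `T = 2 * R`: a point of `K` has some centre closer than `2 * R`, and `p` is at least
        -- as close.
        · intro x hx hxp
          refine hK0 x fun hxK => ?_
          obtain ⟨y, hy, hxy⟩ := hcov x ⟨hxK, hx.1⟩
          linarith [hx.2 y hy]
    _ = ENNReal.ofReal (poincareConst d R ρ) *
          ∫⁻ x in ⋃ p ∈ t, voronoiCell G t p, ‖grad u x‖ₑ ^ 2 := by
        rw [hsum, Finset.mul_sum]
    _ ≤ _ := by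
        gcongr

lemma ofReal_norm_sq_eq_lintegral {F : Type*} [NormedAddCommGroup F]
    {μ : Measure (EuclideanSpace ℝ (Fin d))} (f : Lp F 2 μ) :
    ENNReal.ofReal (‖f‖ ^ 2) = ∫⁻ x, ‖f x‖ₑ ^ 2 ∂μ := by
  have := eLpNorm_nnreal_pow_eq_lintegral (f := f) (μ := μ) (p := 2) (by norm_num)
  rw [ENNReal.ofReal_pow (norm_nonneg _), ofReal_norm, Lp.enorm_def]
  simpa only [NNReal.coe_ofNat, ENNReal.coe_ofNat, ENNReal.rpow_two] using this

/-- The Poincaré inequality on the form domain. -/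
lemma norm_sq_le_of_mem_formDomain (hd : 3 ≤ d) {G S : Set (EuclideanSpace ℝ (Fin d))}
    (hG : IsOpen G) (hGc : Convex ℝ G) {R ρ : ℝ} (hS : IsRelativelyDense G S R ρ)
    {p : L2 G × L2Vec G} (hp : p ∈ formDomain G S hG) :
    ‖p.1‖ ^ 2 ≤ poincareConst d R ρ * ‖p.2‖ ^ 2 := by
  have hC := (poincareConst_pos hd hS.1 (hS.1.trans_le hS.2.1)).le
  have hcl : IsClosed {q : L2 G × L2Vec G | ‖q.1‖ ^ 2 ≤ poincareConst d R ρ * ‖q.2‖ ^ 2} :=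
    isClosed_le (by fun_prop) (by fun_prop)
  -- Both sides are continuous in the Sobolev topology, so the inequality passes from test functions
  -- to their closure.
  refine closure_minimal ?_ hcl hp.1
  rintro q ⟨-, φ, hφ, h1, h2⟩
  have := hφ.lintegral_sq_le hd hG hGc hS
  rw [mem_ofPred_eq, ← ENNReal.ofReal_le_ofReal_iff (by positivity), ENNReal.ofReal_mul hC,
    ofReal_norm_sq_eq_lintegral, ofReal_norm_sq_eq_lintegral]
  have e1 : ∫⁻ x in G, ‖q.1 x‖ₑ ^ 2 = ∫⁻ x in G, ‖φ x‖ₑ ^ 2 :=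
    lintegral_congr_ae (h1.fun_comp fun z => ‖z‖ₑ ^ 2)
  have e2 : ∫⁻ x in G, ‖q.2 x‖ₑ ^ 2 = ∫⁻ x in G, ‖grad φ x‖ₑ ^ 2 :=
    lintegral_congr_ae (h2.fun_comp fun z => ‖z‖ₑ ^ 2)
  rwa [e1, e2]

end MixedLaplacian

/-! ### Resolvent of a form with a Poincaré inequality -/

open scoped ComplexOrder in
/-- If `‖J g‖² ≤ C ‖g‖²`, the operator `1/2 - z J* J` is invertible for `Re z < 1 / (2 C)`. -/
lemma isUnit_half_sub_smul_adjoint_mul {W H : Type*} [NormedAddCommGroup W]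
    [InnerProductSpace ℂ W] [CompleteSpace W] [NormedAddCommGroup H] [InnerProductSpace ℂ H]
    [CompleteSpace H] (J : W →L[ℂ] H) {C : ℝ} (hC : 0 < C) (hJ : ∀ g, ‖J g‖ ^ 2 ≤ C * ‖g‖ ^ 2)
    {z : ℂ} (hz : z.re < 1 / (2 * C)) :
    IsUnit ((1 / 2 : ℂ) • (1 : W →L[ℂ] W) - z • (J.adjoint ∘L J)) := by
  set N : W →L[ℂ] W := J.adjoint ∘L J with hN
  rcases subsingleton_or_nontrivial W with hW | hW
  · have : Subsingleton (W →L[ℂ] W) := ⟨fun f g => ContinuousLinearMap.ext fun x =>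
      Subsingleton.elim _ _⟩
    exact isUnit_of_subsingleton _
  rcases eq_or_ne z 0 with rfl | hz0
  · rw [zero_smul, sub_zero, ← Algebra.algebraMap_eq_smul_one]
    exact (IsUnit.mk0 (1 / 2 : ℂ) (by norm_num)).map _
  have hpos : N.IsPositive := ContinuousLinearMap.isPositive_adjoint_comp_self J
  have hnorm : ‖N‖ ≤ C := by
    have h1 : ‖J‖ ≤ √C := J.opNorm_le_bound (Real.sqrt_nonneg _) fun g => by
      refine abs_le_of_sq_le_sq' ?_ (by positivity) |>.2
      rw [mul_pow, Real.sq_sqrt hC.le]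
      exact hJ g
    calc ‖N‖ ≤ ‖J.adjoint‖ * ‖J‖ := ContinuousLinearMap.opNorm_comp_le _ _
      _ = ‖J‖ * ‖J‖ := by rw [LinearIsometryEquiv.norm_map]
      _ ≤ √C * √C := by gcongr
      _ = C := Real.mul_self_sqrt hC.le
  by_contra hu
  -- The operator equals `z • (1 / (2 * z) - N)`. If it is not invertible, `1 / (2 * z)` is a
  -- spectral value `t` of `N`, hence real with `0 < t ≤ C`, and `z = 1 / (2 * t)` is too large.
  have hmem : 1 / (2 * z) ∈ spectrum ℂ N := by
    rw [spectrum.mem_iff]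
    intro h
    refine hu ?_
    have e : (1 / 2 : ℂ) • (1 : W →L[ℂ] W) - z • N
        = (Units.mk0 z hz0) • (algebraMap ℂ (W →L[ℂ] W) (1 / (2 * z)) - N) := by
      rw [Units.smul_def, Units.val_mk0, smul_sub, Algebra.algebraMap_eq_smul_one, smul_smul]
      congr 2
      field_simp
    rw [e]
    exact h.smul _
  have hle := (spectrum.norm_le_norm_of_mem hmem).trans hnorm
  have hreal := hpos.isSelfAdjoint.mem_spectrum_eq_re hmem
  have hnn : 0 ≤ (1 / (2 * z)).re := by
    have h0 : (0 : W →L[ℂ] W) ≤ N := (ContinuousLinearMap.nonneg_iff_isPositive N).2 hpos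
    have := spectrum_nonneg_of_nonneg h0 hmem
    exact (Complex.le_def.1 this).1
  set t := (1 / (2 * z)).re with ht
  have hzt : z = ((1 / (2 * t) : ℝ) : ℂ) := by
    push_cast
    rw [← hreal]
    field_simp
  have ht0 : 0 < t := lt_of_le_of_ne hnn fun h => hz0 (by rw [hzt, ← h]; simp)
  have htC : t ≤ C := by
    rw [hreal] at hle
    simpa [abs_of_pos ht0] using hle
  have : 1 / (2 * C) ≤ 1 / (2 * t) := by gcongr
  rw [hzt, Complex.ofReal_re] at hz
  linarith

/-- Let `K` be a closed space of pairs `p`, viewed as the domain of the form `1/2 ⟪q.2, p.2⟫`, with a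
Poincaré inequality, and let `r` map the first components to `H` contractively. Then the problem
`1/2 ⟪q.2, p.2⟫ - z ⟪r q.1, r p.1⟫ = ⟪r q.1, f⟫` for all `q ∈ K` is solved by a bounded operator. -/
lemma exists_resolvent_of_form {X Y H : Type*} [NormedAddCommGroup X] [NormedSpace ℂ X]
    [CompleteSpace X] [NormedAddCommGroup Y] [InnerProductSpace ℂ Y] [CompleteSpace Y]
    [NormedAddCommGroup H] [InnerProductSpace ℂ H] [CompleteSpace H] (K : Submodule ℂ (X × Y))
    (hK : IsClosed (K : Set (X × Y))) (r : X →L[ℂ] H) (hr : ∀ x, ‖r x‖ ≤ ‖x‖) {C : ℝ} (hC : 0 < C)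
    (hP : ∀ p ∈ K, ‖p.1‖ ^ 2 ≤ C * ‖p.2‖ ^ 2) {z : ℂ} (hz : z.re < 1 / (2 * C)) :
    ∃ A : H →L[ℂ] H,
      (∀ f, ∃ p ∈ K, r p.1 = A f ∧
        ∀ q ∈ K, (1 / 2 : ℂ) * inner ℂ q.2 p.2 = inner ℂ (r q.1) (f + z • A f)) ∧
      ∀ p ∈ K, ∀ f, (∀ q ∈ K, (1 / 2 : ℂ) * inner ℂ q.2 p.2 = inner ℂ (r q.1) f) →
        A (f - z • r p.1) = r p.1 := by
  have : CompleteSpace K := hK.completeSpace_coe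
  let D : K →L[ℂ] Y := (ContinuousLinearMap.snd ℂ X Y).comp K.subtypeL
  have hP' : ∀ p ∈ K, ‖p.1‖ ≤ √C * ‖p.2‖ := fun p hp => by
    refine abs_le_of_sq_le_sq' ?_ (by positivity) |>.2
    rw [mul_pow, Real.sq_sqrt hC.le]
    exact hP p hp
  -- The norm on pairs is the maximum, so Poincaré bounds it by the second component alone. Hence
  -- the gradient map is injective with closed range, and adjoints on that range are available.
  have hanti : AntilipschitzWith (Real.toNNReal (max √C 1)) D :=
    D.antilipschitz_of_bound fun p => by
      rw [Real.coe_toNNReal _ (by positivity)]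
      change max ‖p.1.1‖ ‖p.1.2‖ ≤ max √C 1 * ‖p.1.2‖
      refine max_le ((hP' p p.2).trans ?_) ?_
      · gcongr
        exact le_max_left _ _
      · exact le_mul_of_one_le_left (norm_nonneg _) (le_max_right _ _)
  have hW : IsClosed (LinearMap.range D.toLinearMap : Set Y) :=
    hanti.isClosed_range D.uniformContinuous
  have : CompleteSpace (LinearMap.range D.toLinearMap) := hW.completeSpace_coe
  let e : K ≃ₗ[ℂ] LinearMap.range D.toLinearMap :=
    LinearEquiv.ofInjective D.toLinearMap hanti.injective
  have he : ∀ p : K, (e p : Y) = p.1.2 := fun p => rfl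
  have he' : ∀ g, (e.symm g).1.2 = (g : Y) := fun g => by rw [← he, e.apply_symm_apply]
  have hb : ∀ g, ‖r (e.symm g).1.1‖ ≤ √C * ‖g‖ := fun g => by
    have := (hr _).trans (hP' _ (e.symm g).2)
    rwa [he'] at this
  let J : LinearMap.range D.toLinearMap →L[ℂ] H := LinearMap.mkContinuous
    ((r.toLinearMap.comp (LinearMap.fst ℂ X Y)).comp
      (K.subtype.comp e.symm.toLinearMap)) √C hb
  have hJ : ∀ g, J g = r (e.symm g).1.1 := fun g => rfl
  have hJe : ∀ p, J (e p) = r p.1.1 := fun p => by rw [hJ, e.symm_apply_apply]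
  have hJC : ∀ g, ‖J g‖ ^ 2 ≤ C * ‖g‖ ^ 2 := fun g => by
    rw [← Real.sq_sqrt hC.le, ← mul_pow, hJ]
    exact pow_le_pow_left₀ (norm_nonneg _) (hb g) 2
  clear_value J e
  obtain ⟨T, hT⟩ := isUnit_half_sub_smul_adjoint_mul J hC hJC hz
  set B := (↑T⁻¹ : LinearMap.range D.toLinearMap →L[ℂ] LinearMap.range D.toLinearMap) with hB
  have hT1 : ∀ g, T.val (B g) = g := fun g => congrArg (fun L => L g) T.mul_inv
  have hT2 : ∀ g, B (T.val g) = g := fun g => congrArg (fun L => L g) T.inv_mul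
  have hTv : ∀ g, T.val g = (1 / 2 : ℂ) • g - z • J.adjoint (J g) := fun g => by rw [hT]; rfl
  -- With `g` the gradient of the solution, the problem reads `T g = J* f`; applying `J` to `g = B
  -- (J* f)` recovers the function itself.
  refine ⟨J ∘L B ∘L J.adjoint, fun f => ?_, fun p hp f hf => ?_⟩
  · set g := B (J.adjoint f) with hg
    refine ⟨(e.symm g).1, (e.symm g).2, (hJ g).symm, fun q hq => ?_⟩
    have h1 : (1 / 2 : ℂ) • g = J.adjoint (f + z • J g) := by
      have := hT1 (J.adjoint f)
      rw [hTv, sub_eq_iff_eq_add] at this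
      rw [map_add, map_smul, ← this]
    have h2 : inner ℂ (e ⟨q, hq⟩) ((1 / 2 : ℂ) • g) = inner ℂ (J (e ⟨q, hq⟩)) (f + z • J g) := by
      rw [h1, ContinuousLinearMap.adjoint_inner_right]
    rw [inner_smul_right, hJe, Submodule.coe_inner, he] at h2
    rw [he']
    exact h2
  · have h1 : J.adjoint f = (1 / 2 : ℂ) • e ⟨p, hp⟩ := by
      refine ext_inner_left ℂ fun v => ?_
      rw [ContinuousLinearMap.adjoint_inner_right, inner_smul_right, hJ,
        ← hf _ (e.symm v).2, he', Submodule.coe_inner, he]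
    have h2 : J.adjoint (f - z • r p.1) = T.val (e ⟨p, hp⟩) := by
      rw [hTv, map_sub, map_smul, h1, hJe]
    change J (B (J.adjoint (f - z • r p.1))) = _
    rw [h2, hT2, hJe]

/-! ### Resolvent set of the mixed Laplacian -/

namespace MixedLaplacian
variable {d : ℕ}

/-- The integral is an inner product with a fixed element of `L²(G)`. -/
lemma continuous_integral_smul {G : Set (EuclideanSpace ℝ (Fin d))}
    {ψ : EuclideanSpace ℝ (Fin d) → ℝ} (hψ : Continuous ψ) (hc : HasCompactSupport ψ) :
    Continuous fun u : L2 G => ∫ x in G, ψ x • u x := by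
  have hm : MemLp (fun x => (ψ x : ℂ)) 2 (volume.restrict G) :=
    ((hψ.memLp_of_hasCompactSupport hc : MemLp ψ 2 volume).restrict G).ofReal
  have e : (fun u : L2 G => ∫ x in G, ψ x • u x) = fun u => inner ℂ (hm.toLp _) u := by
    funext u
    rw [L2.inner_def]
    refine integral_congr_ae ?_
    filter_upwards [hm.coeFn_toLp] with x hx
    rw [hx]
    simp [mul_comm]
  rw [e]
  fun_prop

/-- Each test function and index imposes an equation between continuous functionals of the pair.
Closedness makes the form domain complete, as the resolvent construction requires. -/
lemma isClosed_sobolev (G : Set (EuclideanSpace ℝ (Fin d))) :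
    IsClosed (sobolev G : Set (L2 G × L2Vec G)) := by
  have e : (sobolev G : Set (L2 G × L2Vec G)) = {p | IsWeakGradient G p.1 p.2} := rfl
  rw [e]
  simp only [IsWeakGradient, ofPred_forall]
  refine isClosed_iInter fun φ => isClosed_iInter fun hφ => isClosed_iInter fun hc =>
    isClosed_iInter fun _ => isClosed_iInter fun i => isClosed_eq ?_ ?_
  · exact (continuous_integral_smul (continuous_pderiv hφ i)
      (hasCompactSupport_pderiv hc i)).comp continuous_fst
  · have h := (continuous_integral_smul (G := G) hφ.continuous hc).comp
      (((EuclideanSpace.proj (𝕜 := ℂ) i).compLpL 2 (volume.restrict G)).continuous.comp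
        (continuous_snd (X := L2 G) (Y := L2Vec G)))
    refine (h.neg).congr fun p => ?_
    refine congrArg Neg.neg ?_
    refine integral_congr_ae ?_
    filter_upwards [ContinuousLinearMap.coeFn_compLpL (EuclideanSpace.proj (𝕜 := ℂ) i) p.2]
      with x hx
    exact congrArg (φ x • ·) hx

lemma isClosed_formDomain (G S : Set (EuclideanSpace ℝ (Fin d))) (hG : IsOpen G) :
    IsClosed (formDomain G S hG : Set (L2 G × L2Vec G)) :=
  (Submodule.isClosed_topologicalClosure _).inter (isClosed_sobolev G)

lemma mem_mixedLaplacian_graph {G S : Set (EuclideanSpace ℝ (Fin d))} (hG : IsOpen G)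
    (hS : ∃ C, IsClosed C ∧ S = G ∩ C) {u f : L2Mixed G S} :
    (u, f) ∈ (mixedLaplacian G S hG).graph ↔ ∃ p ∈ formDomain G S hG, restr G S p.1 = u ∧
    ∀ q ∈ formDomain G S hG, (1 / 2 : ℂ) * inner ℂ q.2 p.2 = inner ℂ (restr G S q.1) f := by
  rw [mixedLaplacian_graph hG hS]
  rfl

lemma norm_restr_le {G S : Set (EuclideanSpace ℝ (Fin d))} (u : L2 G) :
    ‖restr G S u‖ ≤ ‖u‖ :=
  norm_Lp_toLp_restrict_le (closure G \ S) u

/-- A Poincaré inequality on the form domain gives a half plane of the resolvent set. -/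
lemma mem_resolventSet_of_poincare {G S : Set (EuclideanSpace ℝ (Fin d))} (hG : IsOpen G)
    (hS : ∃ C, IsClosed C ∧ S = G ∩ C) {C : ℝ} (hC : 0 < C)
    (hP : ∀ p ∈ formDomain G S hG, ‖p.1‖ ^ 2 ≤ C * ‖p.2‖ ^ 2) {z : ℂ} (hz : z.re < 1 / (2 * C)) :
    z ∈ (mixedLaplacian G S hG).resolventSet := by
  obtain ⟨A, hA1, hA2⟩ := exists_resolvent_of_form (formDomain G S hG) (isClosed_formDomain G S hG)
    (restr G S) norm_restr_le hC hP hz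
  refine ⟨A, fun f => ?_, fun u => ?_⟩
  · obtain ⟨y, hy1, hy2⟩ := (LinearPMap.mem_graph_iff _).1
      ((mem_mixedLaplacian_graph hG hS).2 (hA1 f))
    have hy1' : (y : L2Mixed G S) = A f := hy1
    refine ⟨hy1' ▸ y.2, ?_⟩
    have : (⟨A f, hy1' ▸ y.2⟩ : (mixedLaplacian G S hG).domain) = y := Subtype.ext hy1'.symm
    rw [this, hy2, add_sub_cancel_right]
  · obtain ⟨p, hp, hpu, hpf⟩ := (mem_mixedLaplacian_graph hG hS).1
      ((mixedLaplacian G S hG).mem_graph u)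
    rw [← hpu]
    exact hA2 p hp _ hpf

/-- The right side has `2 * 2 ^ d` in place of `3 ^ d`, and 2·2³ = 16 ≤ 27 = 3³ propagates to all `d
≥ 3`. -/
lemma le_one_div_two_mul_poincareConst (hd : 3 ≤ d) {R ρ : ℝ} (hρ : 0 < ρ) (hR : 0 < R) :
    (d : ℝ) * ((d : ℝ) - 2) / 3 ^ d * (ρ ^ (d - 2) / R ^ d) ≤ 1 / (2 * poincareConst d R ρ) := by
  have hd0 : (3 : ℝ) ≤ d := by exact_mod_cast hd
  have h2 : (0 : ℝ) < d - 2 := by linarith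
  have h0 : (0 : ℝ) < d := by linarith
  have e : 1 / (2 * poincareConst d R ρ)
      = (d : ℝ) * ((d : ℝ) - 2) / (2 * 2 ^ d) * (ρ ^ (d - 2) / R ^ d) := by
    rw [poincareConst, mul_pow]
    field_simp
  rw [e]
  have h3 : (2 : ℝ) * 2 ^ d ≤ 3 ^ d := by
    obtain ⟨k, rfl⟩ := Nat.exists_eq_add_of_le hd
    rw [pow_add, pow_add]
    have : (2 : ℝ) ^ k ≤ 3 ^ k := by gcongr; norm_num
    have : (0 : ℝ) < 2 ^ k := by positivity
    linarith
  gcongr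

end MixedLaplacian

end

theorem theorem2p4 (d : ℕ) (hd : 3 ≤ d) (G S : Set (EuclideanSpace ℝ (Fin d)))
    (hG : IsOpen G) (hGc : Convex ℝ G) (R ρ : ℝ) (hS : IsRelativelyDense G S R ρ) :
    (((d : ℝ) * ((d : ℝ) - 2) / 3 ^ d * (ρ ^ (d - 2) / R ^ d) : ℝ) : EReal) ≤
      spectralBottom G S hG := by
  have hρ := hS.1
  have hR : 0 < R := hρ.trans_le hS.2.1
  refine le_iInf₂ fun z hz => EReal.coe_le_coe_iff.2 ?_
  -- A spectral point with real part below `1 / (2 * C)`, where `C` is the Poincaré constant, would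
  -- lie in the resolvent set.
  refine (MixedLaplacian.le_one_div_two_mul_poincareConst hd hρ hR).trans
    (le_of_not_gt fun hlt => hz ?_)
  exact MixedLaplacian.mem_resolventSet_of_poincare hG hS.2.2.2.1
    (MixedLaplacian.poincareConst_pos hd hρ hR)
    (fun p hp => MixedLaplacian.norm_sq_le_of_mem_formDomain hd hG hGc hS hp) hlt
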